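/- Throughout, constants $0<C_1\le C_2$, $\delta>0$, $C>0$, $\beta>0$ and an integer $K\ge 2$ are fixed. A finite simple graph $G=(V,E)$ with $n=|V|$ vertices is called proper (for these constants) if: (P1) $G$ is connected; (P2) any two distinct cycles of length at most $\frac{\ln n}{10\ln\ln n}$ are at distance at least $\beta\,\frac{\ln n}{\ln\ln n}$ from each other; (P3) $G$ contains a triangle, a 5-cycle and a 7-cycle; (P4) for every choice of conductances $c_{ij}$ with $C_1\le c_{ij}\le C_2$ for all $(i,j)\in E$, every $L\subset V$ with $|L|\le K$ and every $S\subset V\setminus L$ with $|S|\le n/2$, $$\sum_{(i,j)\in E,\ i\in S,\ j\in V\setminus(L\cup S)}c_{ij}\ \ge\ \frac{C_1}{6C_2}\sum_{i\in S}c_i',\qquad c_i'=\sum_{j\in V\setminus L,\ (i,j)\in E}c_{ij};$$ (P5) $\delta C\ln n<d(i)<4C\ln n$ for every vertex $i$, where $d(i)$ is the degree of $i$. Corollary 3.2. There is a constant $A>0$, depending only on $C_1,C_2,\delta,C,\beta,K$, such that the following holds for every proper graph $G=(V,E)$ on $n$ vertices and all distinct $x,y\in V$. Give every edge unit conductance and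 let $(V_i)_{i\in V}$ be the potential distribution with boundary set $\{x,y\}$ and $V_x=1$, $V_y=0$; that is, $\sum_{j:(i,j)\in E}(V_i-V_j)=0$ for every $i\in V\setminus\{x,y\}$ (Ohm's and Kirchhoff's laws). Then $$\left|V_i-\frac{d(x)}{d(x)+d(y)}\right|\le\frac{A}{\ln n}\qquad\text{for every } i\in V\setminus\{x,y\}.$$ -/

import Mathlib

/-- `c'_i`: the total conductance at the vertex `i` in the network obtained by deleting the set `L`
of vertices, that is, the sum of `c_{ij}` over the neighbours `j ∉ L` of `i`. A family of
conductances is a function on unordered pairs; only its values on edges matter. -/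
def vertexConductance {V : Type*} [Fintype V] [DecidableEq V] (G : SimpleGraph V)
    [DecidableRel G.Adj] (c : Sym2 V → ℝ) (L : Finset V) (i : V) : ℝ :=
  ∑ j ∈ G.neighborFinset i \ L, c s(i, j)

/-- The total conductance of the edges, in the graph obtained by deleting `L`, with one end in `S`
and the other in the complement of `L ∪ S` (here `S` is disjoint from `L`, and every such edge is
counted once, from its end in `S`). -/
def cutConductance {V : Type*} [Fintype V] [DecidableEq V] (G : SimpleGraph V)
    [DecidableRel G.Adj] (c : Sym2 V → ℝ) (L S : Finset V) : ℝ :=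
  ∑ i ∈ S, ∑ j ∈ G.neighborFinset i \ (L ∪ S), c s(i, j)

/-- `G` has a cycle with `k` edges. -/
def HasCycleOfLength {V : Type*} (G : SimpleGraph V) (k : ℕ) : Prop :=
  ∃ (u : V) (p : G.Walk u u), p.IsCycle ∧ p.length = k

/-- Proper graphs. With `n` the number of vertices, `C₁`, `C₂`, `K`, `δ`, `C` are the constants of
the definition of a proper graph, and `β` is the constant in the distance `β ln n / ln ln n` between
short cycles. -/
structure IsProperGraph {V : Type*} [Fintype V] [DecidableEq V] (G : SimpleGraph V)
    [DecidableRel G.Adj] (C₁ C₂ δ C β : ℝ) (K : ℕ) : Prop where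
  /-- The graph is connected. -/
  connected : G.Connected
  /-- Two different cycles (as subgraphs) of length at most `ln n / (10 ln ln n)` are at distance
  at least `β ln n / ln ln n`. -/
  short_cycles : ∀ (u w : V) (p : G.Walk u u) (q : G.Walk w w), p.IsCycle → q.IsCycle →
    (p.length : ℝ) ≤ Real.log (Fintype.card V) / (10 * Real.log (Real.log (Fintype.card V))) →
    (q.length : ℝ) ≤ Real.log (Fintype.card V) / (10 * Real.log (Real.log (Fintype.card V))) →
    p.toSubgraph ≠ q.toSubgraph →
    ∀ a ∈ p.support, ∀ b ∈ q.support,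
      β * Real.log (Fintype.card V) / Real.log (Real.log (Fintype.card V)) ≤ (G.dist a b : ℝ)
  /-- There are a triangle, a 5-cycle and a 7-cycle. -/
  odd_cycles : HasCycleOfLength G 3 ∧ HasCycleOfLength G 5 ∧ HasCycleOfLength G 7
  /-- Edge expansion, after the deletion of at most `K` vertices, for all conductances between
  `C₁` and `C₂`. The quotient is written as a product. -/
  expansion : ∀ c : Sym2 V → ℝ, (∀ e ∈ G.edgeSet, C₁ ≤ c e ∧ c e ≤ C₂) →
    ∀ L S : Finset V, L.card ≤ K → Disjoint S L → (S.card : ℝ) ≤ (Fintype.card V : ℝ) / 2 →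
      C₁ / (6 * C₂) * ∑ i ∈ S, vertexConductance G c L i ≤ cutConductance G c L S
  /-- All degrees are of order `ln n`. -/
  degrees : ∀ i : V, δ * C * Real.log (Fintype.card V) < (G.degree i : ℝ) ∧
    (G.degree i : ℝ) < 4 * C * Real.log (Fintype.card V)

/-- `v` is a potential distribution of the network `(G, c)` with boundary set `B` and boundary
potentials `b`: it has the prescribed values on `B`, and at every other vertex the currents
`c_{ij} (v_i - v_j)` (Ohm's law) sum to zero (Kirchhoff's current law). -/
def IsPotential {V : Type*} [Fintype V] (G : SimpleGraph V)
    [DecidableRel G.Adj] (c : Sym2 V → ℝ) (B : Finset V) (b v : V → ℝ) : Prop :=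
  (∀ i ∈ B, v i = b i) ∧
    ∀ i ∉ B, ∑ j ∈ G.neighborFinset i, c s(i, j) * (v i - v j) = 0

/-!
The vertices `x`, `y` are deleted and the potential `v` is studied in the remaining graph `H`, with
degrees `d_H`. Let `m` be a median of `v` and `g = v - m`. Off the boundary `g` solves the Poisson
equation `∑_{j ∼ i} (g i - g j) = f i` in `H`, where `f i` is the current that `i` receives directly
from `x` and `y`. By the maximum principle `v` takes values in `[0, 1]`, so `|f| ≤ 2`, and `f` lives
on the `O(ln n)` neighbours of `x` and `y`; hence `∑ f² = O(ln n)`.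

The choice of a median makes `{g > 0}` and `{g < 0}` at most half of the vertices, so the edge
expansion of `H` gives Cheeger's inequality for `g` (`cheeger`). Since the Dirichlet energy of `g`
is `∑ g f` and the degrees are of order `ln n`, it follows that
`∑ g² = O((ln n)⁻² ∑ f²) = O(1 / ln n)` (`sum_sq_le_of_poisson`).

This `ℓ²` bound improves to a pointwise one by using the equation once more: in
`d_H(i) g i = ∑_{j ∼ i} g j + f i` the Cauchy-Schwarz inequality bounds the sum by
`√(d_H(i) ∑ g²) = O(1)`, and therefore `g i = O(1 / ln n)` (`abs_le_of_poisson_apply`,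
`exists_abs_sub_le`).

Finally, the currents leaving `x` and `y` add up to zero, so that
`d(x) = ∑_{j ∼ x} v j + ∑_{j ∼ y} v j = m (d(x) + d(y)) + O(1)`, which identifies `m` up to
`O(1 / ln n)`.
-/

/-! ### Medians -/

open Finset in
/-- A real function on a nonempty finite type has a median among its values. -/
theorem exists_median {V : Type*} [Fintype V] [Nonempty V] (v : V → ℝ) :
    ∃ k, 2 * #{i | v k < v i} ≤ Fintype.card V ∧ 2 * #{i | v i < v k} ≤ Fintype.card V := by
  classical
  obtain ⟨k₀, hk₀⟩ := Finite.exists_max v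
  have hne : ({k | 2 * #{i | v k < v i} ≤ Fintype.card V} : Finset V).Nonempty := by
    refine ⟨k₀, ?_⟩
    have : ({i | v k₀ < v i} : Finset V) = ∅ := by
      ext i; simpa using hk₀ i
    simp [this]
  obtain ⟨k, hk, hmin⟩ := Finset.exists_min_image _ v hne
  simp only [mem_filter, mem_univ, true_and] at hk hmin
  refine ⟨k, hk, ?_⟩
  by_contra! hlt
  have hT : ({i | v i < v k} : Finset V).Nonempty := by
    rw [← Finset.card_pos]; omega
  obtain ⟨k', hk', hmax⟩ := Finset.exists_max_image _ v hT
  simp only [mem_filter, mem_univ, true_and] at hk' hmax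
  refine absurd (hmin k' ?_) (not_le.2 hk')
  have hsub : ({i | v k' < v i} : Finset V) ⊆ ({i | v i < v k} : Finset V)ᶜ := by
    intro i hi
    simp only [mem_filter, mem_univ, true_and, mem_compl] at hi ⊢
    exact fun h => absurd (hmax i h) (not_le.2 hi)
  have := Finset.card_le_card hsub
  rw [Finset.card_compl] at this
  omega

/-! ### Cheeger's inequality for weighted graphs -/

/-- A coarea inequality: both sides are additive in the layers of `u`, so the isoperimetric
inequality for the superlevel sets of `u` passes to `u` itself. -/
theorem coarea_le {V : Type*} [Fintype V] [DecidableEq V] (a : V → V → ℝ) (h : ℝ) (u : V → ℝ)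
    (hu : ∀ i, 0 ≤ u i)
    (hS : ∀ S : Finset V, (∀ i ∈ S, 0 < u i) →
      h * ∑ i ∈ S, ∑ j, a i j ≤ ∑ i ∈ S, ∑ j ∈ Sᶜ, a i j) :
    h * ∑ i, u i * ∑ j, a i j ≤ ∑ i, ∑ j, a i j * max (u i - u j) 0 := by
  induction hn : (Finset.univ.filter fun i => 0 < u i).card using Nat.strong_induction_on
    generalizing u with
  | _ n ih =>
  set S := Finset.univ.filter fun i => 0 < u i with hSdef
  have hmem : ∀ i, i ∈ S ↔ 0 < u i := by simp [hSdef]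
  rcases S.eq_empty_or_nonempty with hE | hne
  · have h0 : ∀ i, u i = 0 := fun i =>
      le_antisymm (not_lt.1 fun hi => by simpa [hE] using (hmem i).2 hi) (hu i)
    simp [h0]
  obtain ⟨k, hk, hmin⟩ := Finset.exists_min_image S u hne
  have hpos : 0 < u k := (hmem k).1 hk
  have h0 : ∀ i, i ∉ S → u i = 0 := fun i hi =>
    le_antisymm (not_lt.1 fun hi' => hi ((hmem i).2 hi')) (hu i)
  -- subtract from `u` its smallest positive value, on the support
  set w : V → ℝ := fun i => if i ∈ S then u i - u k else 0 with hw
  have hw0 : ∀ i, 0 ≤ w i := fun i => by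
    simp only [hw]; split_ifs with hi
    · linarith [hmin i hi]
    · exact le_rfl
  have hwS : ∀ i, 0 < w i → i ∈ S := fun i hi => by
    by_contra hc; simp [hw, hc] at hi
  have hrec := ih _ (by
    rw [← hn]
    refine Finset.card_lt_card ⟨fun i hi => hwS i (by simpa using hi), fun hsub => ?_⟩
    have := hsub hk
    simp [hw, hk] at this) w hw0 (fun T hT => hS T fun i hi => (hmem i).1 (hwS i (hT i hi))) rfl
  have hcut := hS S fun i hi => (hmem i).1 hi
  have hL : ∑ i, u i * ∑ j, a i j = u k * ∑ i ∈ S, ∑ j, a i j + ∑ i, w i * ∑ j, a i j := by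
    rw [← Finset.sum_filter_add_sum_filter_not Finset.univ (· ∈ S) (fun i => u i * ∑ j, a i j),
      ← Finset.sum_filter_add_sum_filter_not Finset.univ (· ∈ S) (fun i => w i * ∑ j, a i j)]
    have e1 : ∑ i with i ∉ S, u i * ∑ j, a i j = 0 :=
      Finset.sum_eq_zero fun i hi => by simp [h0 i (Finset.mem_filter.1 hi).2]
    have e2 : ∑ i with i ∉ S, w i * ∑ j, a i j = 0 :=
      Finset.sum_eq_zero fun i hi => by simp [hw, (Finset.mem_filter.1 hi).2]
    rw [e1, e2, Finset.filter_univ_mem, Finset.mul_sum, add_zero, add_zero,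
      ← Finset.sum_add_distrib]
    refine Finset.sum_congr rfl fun i hi => ?_
    simp only [hw, hi, if_true]; ring
  have hR : ∑ i, ∑ j, a i j * max (u i - u j) 0 =
      u k * ∑ i ∈ S, ∑ j ∈ Sᶜ, a i j + ∑ i, ∑ j, a i j * max (w i - w j) 0 := by
    have e : ∑ i ∈ S, ∑ j ∈ Sᶜ, a i j = ∑ i, ∑ j, if i ∈ S ∧ j ∉ S then a i j else 0 := by
      rw [← Finset.sum_filter_add_sum_filter_not Finset.univ (· ∈ S)
        (fun i => ∑ j, if i ∈ S ∧ j ∉ S then a i j else 0)]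
      rw [Finset.filter_univ_mem, Finset.sum_eq_zero (s := Finset.univ.filter (· ∉ S))
        (fun i hi => by simp [(Finset.mem_filter.1 hi).2]), add_zero]
      refine Finset.sum_congr rfl fun i hi => ?_
      simp only [hi, true_and]
      rw [← Finset.sum_filter]
      congr 1
      ext j; simp
    rw [e, Finset.mul_sum, ← Finset.sum_add_distrib]
    refine Finset.sum_congr rfl fun i _ => ?_
    rw [Finset.mul_sum, ← Finset.sum_add_distrib]
    refine Finset.sum_congr rfl fun j _ => ?_
    by_cases hi : i ∈ S <;> by_cases hj : j ∈ S
    · simp [hw, hi, hj]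
    · have := hmin i hi
      simp only [hw, hi, hj, h0 j hj, if_true, if_false, not_false_eq_true, and_self, sub_zero]
      rw [max_eq_left (hu i), max_eq_left (by linarith)]
      ring
    · have := hmin j hj
      simp only [hw, hi, hj, h0 i hi, if_true, if_false, false_and, zero_sub]
      rw [max_eq_right (by linarith), max_eq_right (by linarith)]
      ring
    · simp [hw, hi, hj, h0 i hi, h0 j hj]
  rw [hL, hR, mul_add]
  have := mul_le_mul_of_nonneg_left hcut hpos.le
  linarith

/-- Cheeger's inequality for a nonnegative function: the coarea inequality is applied to `g ^ 2`. -/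
theorem cheeger_of_nonneg {V : Type*} [Fintype V] [DecidableEq V] (a : V → V → ℝ) {h : ℝ}
    (hh : 0 < h) (ha : ∀ i j, 0 ≤ a i j) (hsymm : ∀ i j, a i j = a j i) (g : V → ℝ)
    (hg : ∀ i, 0 ≤ g i)
    (hS : ∀ S : Finset V, (∀ i ∈ S, 0 < g i) →
      h * ∑ i ∈ S, ∑ j, a i j ≤ ∑ i ∈ S, ∑ j ∈ Sᶜ, a i j) :
    h ^ 2 * ∑ i, g i ^ 2 * ∑ j, a i j ≤ ∑ i, ∑ j, a i j * (g i - g j) ^ 2 := by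
  have hco := coarea_le a h (fun i => g i ^ 2) (fun i => sq_nonneg _)
    (fun S hS' => hS S fun i hi => by
      have := hS' i hi
      exact lt_of_le_of_ne (hg i) fun h0 => by simp [← h0] at this)
  set D := ∑ i, g i ^ 2 * ∑ j, a i j with hD
  set Q := ∑ i, ∑ j, a i j * (g i - g j) ^ 2 with hQ
  have hD0 : 0 ≤ D := Finset.sum_nonneg fun i _ =>
    mul_nonneg (sq_nonneg _) (Finset.sum_nonneg fun j _ => ha i j)
  have swap : ∀ F : V → V → ℝ, ∑ i, ∑ j, a i j * F i j = ∑ i, ∑ j, a i j * F j i := by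
    intro F
    rw [Finset.sum_comm]
    exact Finset.sum_congr rfl fun i _ => Finset.sum_congr rfl fun j _ => by rw [hsymm]
  have hD' : D = ∑ i, ∑ j, a i j * g i ^ 2 :=
    Finset.sum_congr rfl fun i _ => by
      rw [Finset.mul_sum]; exact Finset.sum_congr rfl fun j _ => mul_comm _ _
  have hD'' : D = ∑ i, ∑ j, a i j * g j ^ 2 := by rw [hD', swap]
  -- the AM-GM form of Cauchy-Schwarz, with the parameter `h`
  have key : ∑ i, ∑ j, a i j * max (g i ^ 2 - g j ^ 2) 0 +
      ∑ i, ∑ j, a i j * max (g j ^ 2 - g i ^ 2) 0 ≤ Q / h + h / 4 * (2 * D + 2 * D) := by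
    nth_rewrite 1 [hD']
    rw [hD'', hQ, Finset.sum_div]
    simp only [Finset.sum_div, Finset.mul_sum, ← Finset.sum_add_distrib]
    refine Finset.sum_le_sum fun i _ => Finset.sum_le_sum fun j _ => ?_
    have e : max (g i ^ 2 - g j ^ 2) 0 + max (g j ^ 2 - g i ^ 2) 0 ≤
        (g i - g j) ^ 2 / h + h / 4 * (2 * g i ^ 2 + 2 * g j ^ 2) := by
      have hsplit : max (g i ^ 2 - g j ^ 2) 0 + max (g j ^ 2 - g i ^ 2) 0 =
          |g i - g j| * (g i + g j) := by
        rcases le_total (g i) (g j) with hle | hle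
        · have := pow_le_pow_left₀ (hg i) hle 2
          rw [max_eq_right (by linarith), max_eq_left (by linarith),
            abs_of_nonpos (by linarith)]
          ring
        · have := pow_le_pow_left₀ (hg j) hle 2
          rw [max_eq_left (by linarith), max_eq_right (by linarith),
            abs_of_nonneg (by linarith)]
          ring
      rw [hsplit, ← sq_abs (g i - g j), div_add' _ _ _ (by positivity), le_div_iff₀ (by positivity)]
      nlinarith [sq_nonneg (|g i - g j| - h / 2 * (g i + g j)), mul_nonneg (sq_nonneg h)
        (sq_nonneg (g i - g j)), sq_abs (g i - g j)]
    have := mul_le_mul_of_nonneg_left e (ha i j)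
    calc _ = a i j * (max (g i ^ 2 - g j ^ 2) 0 + max (g j ^ 2 - g i ^ 2) 0) := by ring
      _ ≤ _ := this
      _ = _ := by ring
  rw [← swap fun i j => max (g i ^ 2 - g j ^ 2) 0] at key
  have h1 : 2 * (h * D) ≤ Q / h + h / 4 * (2 * D + 2 * D) := by linarith
  have h2 : h * D ≤ Q / h := by linarith
  rw [le_div_iff₀ hh] at h2
  linarith

/-- Cheeger's inequality for a function of either sign, assuming expansion of the subsets of
`{g > 0}` and of `{g < 0}`. The sum on the right runs over ordered pairs, so it is twice the
Dirichlet energy. -/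
theorem cheeger {V : Type*} [Fintype V] [DecidableEq V] (a : V → V → ℝ) {h : ℝ}
    (hh : 0 < h) (ha : ∀ i j, 0 ≤ a i j) (hsymm : ∀ i j, a i j = a j i) (g : V → ℝ)
    (hpos : ∀ S : Finset V, (∀ i ∈ S, 0 < g i) →
      h * ∑ i ∈ S, ∑ j, a i j ≤ ∑ i ∈ S, ∑ j ∈ Sᶜ, a i j)
    (hneg : ∀ S : Finset V, (∀ i ∈ S, g i < 0) →
      h * ∑ i ∈ S, ∑ j, a i j ≤ ∑ i ∈ S, ∑ j ∈ Sᶜ, a i j) :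
    h ^ 2 * ∑ i, g i ^ 2 * ∑ j, a i j ≤ ∑ i, ∑ j, a i j * (g i - g j) ^ 2 := by
  have h1 := cheeger_of_nonneg a hh ha hsymm (fun i => max (g i) 0) (fun i => le_max_right _ _)
    (fun S hS => hpos S fun i hi => by simpa using hS i hi)
  have h2 := cheeger_of_nonneg a hh ha hsymm (fun i => max (-g i) 0) (fun i => le_max_right _ _)
    (fun S hS => hneg S fun i hi => by simpa using hS i hi)
  have hsq : ∀ t : ℝ, t ^ 2 = max t 0 ^ 2 + max (-t) 0 ^ 2 := fun t => by
    rcases le_total t 0 with ht | ht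
    · rw [max_eq_right ht, max_eq_left (by linarith)]; ring
    · rw [max_eq_left ht, max_eq_right (by linarith)]; ring
  have hdiff : ∀ s t : ℝ,
      (max s 0 - max t 0) ^ 2 + (max (-s) 0 - max (-t) 0) ^ 2 ≤ (s - t) ^ 2 := fun s t => by
    rcases le_total s 0 with hs | hs <;> rcases le_total t 0 with ht | ht
    · rw [max_eq_right hs, max_eq_right ht, max_eq_left (by linarith : (0 : ℝ) ≤ -s),
        max_eq_left (by linarith : (0 : ℝ) ≤ -t)]
      nlinarith
    · rw [max_eq_right hs, max_eq_left ht, max_eq_left (by linarith : (0 : ℝ) ≤ -s),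
        max_eq_right (by linarith : -t ≤ (0 : ℝ))]
      nlinarith
    · rw [max_eq_left hs, max_eq_right ht, max_eq_right (by linarith : -s ≤ (0 : ℝ)),
        max_eq_left (by linarith : (0 : ℝ) ≤ -t)]
      nlinarith
    · rw [max_eq_left hs, max_eq_left ht, max_eq_right (by linarith : -s ≤ (0 : ℝ)),
        max_eq_right (by linarith : -t ≤ (0 : ℝ))]
      nlinarith
  calc h ^ 2 * ∑ i, g i ^ 2 * ∑ j, a i j
      = h ^ 2 * ∑ i, max (g i) 0 ^ 2 * ∑ j, a i j
        + h ^ 2 * ∑ i, max (-g i) 0 ^ 2 * ∑ j, a i j := by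
        rw [← mul_add, ← Finset.sum_add_distrib]
        congr 1
        exact Finset.sum_congr rfl fun i _ => by rw [hsq (g i)]; ring
    _ ≤ _ := add_le_add h1 h2
    _ ≤ _ := by
        simp only [← Finset.sum_add_distrib, ← mul_add]
        exact Finset.sum_le_sum fun i _ => Finset.sum_le_sum fun j _ =>
          mul_le_mul_of_nonneg_left (hdiff _ _) (ha i j)

/-! ### The Poisson equation on an expander -/

/-- Summation by parts for the Dirichlet energy. -/
theorem sum_mul_sub_sq {V : Type*} [Fintype V] (a : V → V → ℝ)
    (hsymm : ∀ i j, a i j = a j i) (g : V → ℝ) :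
    ∑ i, ∑ j, a i j * (g i - g j) ^ 2 = 2 * ∑ i, g i * ∑ j, a i j * (g i - g j) := by
  have e1 : ∑ i, g i * ∑ j, a i j * (g i - g j) = ∑ i, ∑ j, g i * (a i j * (g i - g j)) :=
    Finset.sum_congr rfl fun i _ => Finset.mul_sum _ _ _
  have e2 : ∑ i, ∑ j, g i * (a i j * (g i - g j)) = ∑ i, ∑ j, g j * (a i j * (g j - g i)) := by
    rw [Finset.sum_comm]
    exact Finset.sum_congr rfl fun i _ => Finset.sum_congr rfl fun j _ => by rw [hsymm]
  rw [two_mul, e1]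
  nth_rewrite 2 [e2]
  simp only [← Finset.sum_add_distrib]
  exact Finset.sum_congr rfl fun i _ => Finset.sum_congr rfl fun j _ => by ring

/-- The `ℓ²` estimate for a solution `g` of the Poisson equation with source `f`, from Cheeger's
inequality. The equation and the lower bound on degrees are needed only on the support of `g`, so
`g` may be extended by zero to deleted vertices. -/
theorem sum_sq_le_of_poisson {V : Type*} [Fintype V] [DecidableEq V] (a : V → V → ℝ) {h D₀ : ℝ}
    (hh : 0 < h) (hD₀ : 0 < D₀) (ha : ∀ i j, 0 ≤ a i j) (hsymm : ∀ i j, a i j = a j i)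
    (g f : V → ℝ)
    (hpos : ∀ S : Finset V, (∀ i ∈ S, 0 < g i) →
      h * ∑ i ∈ S, ∑ j, a i j ≤ ∑ i ∈ S, ∑ j ∈ Sᶜ, a i j)
    (hneg : ∀ S : Finset V, (∀ i ∈ S, g i < 0) →
      h * ∑ i ∈ S, ∑ j, a i j ≤ ∑ i ∈ S, ∑ j ∈ Sᶜ, a i j)
    (hdeg : ∀ i, g i ≠ 0 → D₀ ≤ ∑ j, a i j)
    (hf : ∀ i, g i ≠ 0 → ∑ j, a i j * (g i - g j) = f i) :
    (h ^ 2 * D₀) ^ 2 * ∑ i, g i ^ 2 ≤ 4 * ∑ i, f i ^ 2 := by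
  have h1 := cheeger a hh ha hsymm g hpos hneg
  rw [sum_mul_sub_sq a hsymm] at h1
  have h2 : ∑ i, g i * ∑ j, a i j * (g i - g j) = ∑ i, g i * f i :=
    Finset.sum_congr rfl fun i _ => by
      by_cases hi : g i = 0
      · simp [hi]
      · rw [hf i hi]
  have h3 : D₀ * ∑ i, g i ^ 2 ≤ ∑ i, g i ^ 2 * ∑ j, a i j := by
    rw [Finset.mul_sum]
    refine Finset.sum_le_sum fun i _ => ?_
    by_cases hi : g i = 0
    · simp [hi]
    · rw [mul_comm]; exact mul_le_mul_of_nonneg_left (hdeg i hi) (sq_nonneg _)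
  have h4 : h ^ 2 * D₀ * ∑ i, g i ^ 2 ≤ 2 * ∑ i, g i * f i := by
    have := mul_le_mul_of_nonneg_left h3 (sq_nonneg h)
    rw [h2] at h1
    linarith
  -- `2 g f ≤ (q / 2) g² + (2 / q) f²` with `q = h² D₀`, in polynomial form
  have h5 : h ^ 2 * D₀ * (2 * ∑ i, g i * f i) ≤
      (h ^ 2 * D₀) ^ 2 / 2 * ∑ i, g i ^ 2 + 2 * ∑ i, f i ^ 2 := by
    simp only [Finset.mul_sum, ← Finset.sum_add_distrib]
    refine Finset.sum_le_sum fun i _ => ?_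
    nlinarith [sq_nonneg (h ^ 2 * D₀ * g i - 2 * f i)]
  have h6 := mul_le_mul_of_nonneg_left h4 (by positivity : 0 ≤ h ^ 2 * D₀)
  nlinarith

/-- From an `ℓ²` bound to a pointwise bound: `g i` is the mean of the values of `g` at the
neighbours of `i`, up to the source term, and the mean is bounded by Cauchy-Schwarz. -/
theorem abs_le_of_poisson_apply {V : Type*} [Fintype V] (a : V → V → ℝ)
    (ha : ∀ i j, a i j = 0 ∨ a i j = 1) (g : V → ℝ) (i : V) {D₀ D₁ F M : ℝ}
    (hD₀ : D₀ ≤ ∑ j, a i j) (hD₁ : ∑ j, a i j ≤ D₁)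
    (hF : |∑ j, a i j * (g i - g j)| ≤ F) (hM : 0 ≤ M) (hg : D₁ * ∑ j, g j ^ 2 ≤ M ^ 2) :
    D₀ * |g i| ≤ M + F := by
  have hsum : |∑ j, a i j * g j| ≤ M := by
    refine abs_le_of_sq_le_sq ?_ hM
    refine (Finset.sum_mul_sq_le_sq_mul_sq Finset.univ (a i) g).trans (le_trans ?_ hg)
    have : ∑ j, a i j ^ 2 = ∑ j, a i j := Finset.sum_congr rfl fun j _ => by
      rcases ha i j with h | h <;> simp [h]
    rw [this]
    exact mul_le_mul_of_nonneg_right hD₁ (Finset.sum_nonneg fun j _ => sq_nonneg _)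
  have hd0 : 0 ≤ ∑ j, a i j := Finset.sum_nonneg fun j _ => by
    rcases ha i j with h | h <;> simp [h]
  have e : (∑ j, a i j) * g i = ∑ j, a i j * g j + ∑ j, a i j * (g i - g j) := by
    rw [Finset.sum_mul, ← Finset.sum_add_distrib]
    exact Finset.sum_congr rfl fun j _ => by ring
  calc D₀ * |g i| ≤ (∑ j, a i j) * |g i| := mul_le_mul_of_nonneg_right hD₀ (abs_nonneg _)
    _ = |(∑ j, a i j) * g i| := by rw [abs_mul, abs_of_nonneg hd0]
    _ ≤ |∑ j, a i j * g j| + |∑ j, a i j * (g i - g j)| := by rw [e]; exact abs_add_le _ _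
    _ ≤ M + F := add_le_add hsum hF

/-! ### Harmonic functions with boundary -/

/-- The maximum principle: a function harmonic off `B` is bounded above by its bound on `B`. -/
theorem le_of_harmonic_off {V : Type*} [Fintype V] [DecidableEq V] (G : SimpleGraph V)
    [DecidableRel G.Adj] (hG : G.Connected) (B : Finset V) (hB : B.Nonempty) (v : V → ℝ) (M : ℝ)
    (hv : ∀ i ∈ B, v i ≤ M) (hharm : ∀ i ∉ B, ∑ j ∈ G.neighborFinset i, (v i - v j) = 0) (i : V) :
    v i ≤ M := by
  have := hG.nonempty
  obtain ⟨k, hk⟩ := Finite.exists_max v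
  refine (hk i).trans ?_
  by_contra! hlt
  have hprop : ∀ {p q : V}, G.Walk p q → v p = v k → v q = v k := by
    intro p q w
    induction w with
    | nil => exact id
    | @cons p r q hadj _ ih =>
      intro hp
      refine ih ?_
      have hpB : p ∉ B := fun hpB => absurd (hv p hpB) (not_le.2 (hp ▸ hlt))
      have h0 := (Finset.sum_eq_zero_iff_of_nonneg (fun j _ => by
        rw [hp]; exact sub_nonneg.2 (hk j))).1 (hharm p hpB) r (by simpa using hadj)
      linarith
  obtain ⟨b, hb⟩ := hB
  obtain ⟨w⟩ := hG.preconnected k b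
  exact absurd (hv b hb) (not_le.2 ((hprop w rfl).symm ▸ hlt))

/-- The currents flowing out of the boundary vertices sum to zero. -/
theorem sum_current_boundary {V : Type*} [Fintype V] [DecidableEq V] (G : SimpleGraph V)
    [DecidableRel G.Adj] (B : Finset V) (v : V → ℝ)
    (hharm : ∀ i ∉ B, ∑ j ∈ G.neighborFinset i, (v i - v j) = 0) :
    ∑ i ∈ B, ∑ j ∈ G.neighborFinset i, (v i - v j) = 0 := by
  have h1 : ∑ i, ∑ j ∈ G.neighborFinset i, (v i - v j) =
      ∑ i ∈ B, ∑ j ∈ G.neighborFinset i, (v i - v j) :=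
    (Finset.sum_subset (Finset.subset_univ B) fun i _ hi => hharm i hi).symm
  have h2 : ∑ i, ∑ j ∈ G.neighborFinset i, (v i - v j) =
      ∑ i, ∑ j, if G.Adj i j then v i - v j else 0 :=
    Finset.sum_congr rfl fun i _ => by
      rw [← Finset.sum_filter]; congr 1; ext j; simp
  have h3 : ∑ i, ∑ j, (if G.Adj i j then v i - v j else 0) =
      -∑ i, ∑ j, (if G.Adj i j then v i - v j else 0) := by
    conv_lhs => rw [Finset.sum_comm]
    rw [← Finset.sum_neg_distrib]
    refine Finset.sum_congr rfl fun i _ => ?_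
    rw [← Finset.sum_neg_distrib]
    refine Finset.sum_congr rfl fun j _ => ?_
    simp only [G.adj_comm j i]
    split_ifs <;> simp
  rw [← h1, h2]
  linarith

/-! ### Deleting vertices from a proper graph -/

/-- The adjacency matrix of the graph obtained from `G` by deleting the vertices in `L`. It remains
indexed by all of `V`, with zero rows and columns at the deleted vertices. -/
def deletedAdj {V : Type*} [DecidableEq V] (G : SimpleGraph V) [DecidableRel G.Adj]
    (L : Finset V) (i j : V) : ℝ :=
  if G.Adj i j ∧ i ∉ L ∧ j ∉ L then 1 else 0

theorem deletedAdj_comm {V : Type*} [DecidableEq V] (G : SimpleGraph V) [DecidableRel G.Adj]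
    (L : Finset V) (i j : V) : deletedAdj G L i j = deletedAdj G L j i := by
  unfold deletedAdj
  congr 1
  rw [G.adj_comm, and_comm (a := i ∉ L)]

theorem deletedAdj_eq_zero_or_one {V : Type*} [DecidableEq V] (G : SimpleGraph V)
    [DecidableRel G.Adj] (L : Finset V) (i j : V) :
    deletedAdj G L i j = 0 ∨ deletedAdj G L i j = 1 := by
  unfold deletedAdj
  split_ifs <;> simp

theorem deletedAdj_nonneg {V : Type*} [DecidableEq V] (G : SimpleGraph V)
    [DecidableRel G.Adj] (L : Finset V) (i j : V) : 0 ≤ deletedAdj G L i j := by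
  rcases deletedAdj_eq_zero_or_one G L i j with h | h <;> simp [h]

theorem sum_deletedAdj_mul {V : Type*} [Fintype V] [DecidableEq V] (G : SimpleGraph V)
    [DecidableRel G.Adj] (L T : Finset V) {i : V} (hi : i ∉ L) (F : V → ℝ) :
    ∑ j ∈ T, deletedAdj G L i j * F j = ∑ j ∈ (G.neighborFinset i \ L) ∩ T, F j := by
  rw [Finset.inter_comm, ← Finset.filter_mem_eq_inter, Finset.sum_filter]
  refine Finset.sum_congr rfl fun j _ => ?_
  simp [deletedAdj, hi]

/-- Edge expansion of the deleted graph with unit conductances. Unit conductances need not lie in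
`[C₁, C₂]`, but the inequality is homogeneous, so the constant conductance `C₁` serves. -/
theorem expansion_deletedAdj {V : Type*} [Fintype V] [DecidableEq V] {G : SimpleGraph V}
    [DecidableRel G.Adj] {C₁ C₂ δ C β : ℝ} {K : ℕ} (hC₁ : 0 < C₁) (hC₁₂ : C₁ ≤ C₂)
    (hG : IsProperGraph G C₁ C₂ δ C β K) {L S : Finset V} (hL : L.card ≤ K)
    (hSL : ∀ i ∈ S, i ∉ L) (hS : 2 * S.card ≤ Fintype.card V) :
    C₁ / (6 * C₂) * ∑ i ∈ S, ∑ j, deletedAdj G L i j ≤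
      ∑ i ∈ S, ∑ j ∈ Sᶜ, deletedAdj G L i j := by
  have hS' : (S.card : ℝ) ≤ (Fintype.card V : ℝ) / 2 := by
    have : (2 * S.card : ℝ) ≤ Fintype.card V := by exact_mod_cast hS
    linarith
  have h := hG.expansion (fun _ => C₁) (fun e _ => ⟨le_rfl, hC₁₂⟩) L S hL
    (Finset.disjoint_left.2 hSL) hS'
  have e1 : ∑ i ∈ S, vertexConductance G (fun _ => C₁) L i =
      C₁ * ∑ i ∈ S, ∑ j, deletedAdj G L i j := by
    rw [Finset.mul_sum]
    refine Finset.sum_congr rfl fun i hi => ?_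
    have := sum_deletedAdj_mul G L Finset.univ (hSL i hi) (fun _ => 1)
    simp only [mul_one, Finset.inter_univ] at this
    rw [this, vertexConductance, Finset.mul_sum]
    simp
  have e2 : cutConductance G (fun _ => C₁) L S =
      C₁ * ∑ i ∈ S, ∑ j ∈ Sᶜ, deletedAdj G L i j := by
    rw [cutConductance, Finset.mul_sum]
    refine Finset.sum_congr rfl fun i hi => ?_
    have := sum_deletedAdj_mul G L Sᶜ (hSL i hi) (fun _ => 1)
    simp only [mul_one] at this
    rw [this, Finset.mul_sum]
    have : G.neighborFinset i \ (L ∪ S) = (G.neighborFinset i \ L) ∩ Sᶜ := by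
      ext; simp; tauto
    rw [this]; simp
  rw [e1, e2, mul_left_comm] at h
  exact le_of_mul_le_mul_left h hC₁

theorem sum_deletedAdj_le_degree {V : Type*} [Fintype V] [DecidableEq V] (G : SimpleGraph V)
    [DecidableRel G.Adj] (L : Finset V) {i : V} (hi : i ∉ L) :
    ∑ j, deletedAdj G L i j ≤ G.degree i := by
  have := sum_deletedAdj_mul G L Finset.univ hi (fun _ => 1)
  simp only [mul_one, Finset.inter_univ, Finset.sum_const, nsmul_eq_mul] at this
  rw [this, ← G.card_neighborFinset_eq_degree]
  exact_mod_cast Finset.card_le_card Finset.sdiff_subset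

theorem degree_sub_card_le_sum_deletedAdj {V : Type*} [Fintype V] [DecidableEq V]
    (G : SimpleGraph V) [DecidableRel G.Adj] (L : Finset V) {i : V} (hi : i ∉ L) :
    (G.degree i : ℝ) - L.card ≤ ∑ j, deletedAdj G L i j := by
  have := sum_deletedAdj_mul G L Finset.univ hi (fun _ => 1)
  simp only [mul_one, Finset.inter_univ, Finset.sum_const, nsmul_eq_mul] at this
  rw [this, ← G.card_neighborFinset_eq_degree, sub_le_iff_le_add]
  have := Finset.le_card_sdiff L (G.neighborFinset i)
  exact_mod_cast (by omega : (G.neighborFinset i).card ≤ (G.neighborFinset i \ L).card + L.card)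

/-! ### Potentials with two boundary vertices -/

/-- Off the boundary `{x, y}` the potential is within `O(1 / ln n)` of a constant, its median. The
size condition ensures that `δ C ln n - 2`, a lower bound for the degrees after the deletion of
`x` and `y`, is at least half of `δ C ln n`. -/
theorem exists_abs_sub_le {V : Type*} [Fintype V] [DecidableEq V] {G : SimpleGraph V}
    [DecidableRel G.Adj] {C₁ C₂ δ C β : ℝ} {K : ℕ} (hC₁ : 0 < C₁) (hC₁₂ : C₁ ≤ C₂)
    (hδ : 0 < δ) (hC : 0 < C) (hK : 2 ≤ K)
    (hG : IsProperGraph G C₁ C₂ δ C β K) {x y : V} (hxy : x ≠ y) {v : V → ℝ}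
    (hv : ∀ i, 0 ≤ v i ∧ v i ≤ 1)
    (hharm : ∀ i ∉ ({x, y} : Finset V), ∑ j ∈ G.neighborFinset i, (v i - v j) = 0)
    (hlarge : 4 ≤ δ * C * Real.log (Fintype.card V)) :
    ∃ m, 0 ≤ m ∧ m ≤ 1 ∧ ∀ i, i ≠ x → i ≠ y →
      |v i - m| ≤ (32 / ((C₁ / (6 * C₂)) ^ 2 * δ) + 2) * (2 / (δ * C)) /
        Real.log (Fintype.card V) := by
  have := hG.connected.nonempty
  obtain ⟨k, hgt, hlt⟩ := exists_median v
  refine ⟨v k, (hv k).1, (hv k).2, ?_⟩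
  set ℓ := Real.log (Fintype.card V) with hℓ
  set h := C₁ / (6 * C₂) with hh
  have hC₂ : 0 < C₂ := hC₁.trans_le hC₁₂
  have hh0 : 0 < h := by positivity
  have hδC : 0 < δ * C := by positivity
  have hℓ0 : 0 < ℓ := by
    by_contra! hc
    nlinarith [mul_nonneg hδC.le (neg_nonneg.2 hc)]
  set L : Finset V := {x, y} with hL
  have hLcard : L.card = 2 := Finset.card_pair hxy
  set a := deletedAdj G L with ha
  set g : V → ℝ := fun i => if i ∈ L then 0 else v i - v k with hg
  have hgL : ∀ i, g i ≠ 0 → i ∉ L := fun i hi hiL => hi (by simp [hg, hiL])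
  -- the current entering `i` directly from the boundary: the source of the Poisson equation
  -- satisfied by `g` in the deleted graph
  set f : V → ℝ := fun i => -∑ j ∈ G.neighborFinset i ∩ L, (v i - v j) with hf
  have hfle : ∀ i, |f i| ≤ (G.neighborFinset i ∩ L).card := fun i => by
    rw [hf, abs_neg]
    refine (Finset.abs_sum_le_sum_abs _ _).trans ?_
    rw [← nsmul_one, ← Finset.sum_const]
    refine Finset.sum_le_sum fun j _ => abs_le.2 ⟨?_, ?_⟩ <;> linarith [hv i, hv j]
  have hfle2 : ∀ i, |f i| ≤ 2 := fun i => (hfle i).trans (by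
    have := Finset.card_le_card (Finset.inter_subset_right : G.neighborFinset i ∩ L ⊆ L)
    rw [hLcard] at this
    exact_mod_cast this)
  have hfeq : ∀ i, i ∉ L → ∑ j, a i j * (g i - g j) = f i := fun i hi => by
    rw [ha, sum_deletedAdj_mul G L Finset.univ hi, Finset.inter_univ, hf, eq_neg_iff_add_eq_zero,
      ← hharm i hi, ← Finset.sum_inter_add_sum_sdiff (G.neighborFinset i) L, add_comm]
    congr 1
    refine Finset.sum_congr rfl fun j hj => ?_
    simp only [hg, hi, (Finset.mem_sdiff.1 hj).2, if_false]
    ring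
  have hdegL : ∀ i, i ∉ L → δ * C * ℓ / 2 ≤ ∑ j, a i j := fun i hi => by
    have h1 := degree_sub_card_le_sum_deletedAdj G L hi
    have h2 := (hG.degrees i).1
    rw [hLcard] at h1
    push_cast at h1
    linarith
  have hsumf : ∑ i, f i ^ 2 ≤ 16 * C * ℓ := by
    have h1 : ∀ i, f i ^ 2 ≤ 2 * ∑ j ∈ L, if G.Adj j i then (1 : ℝ) else 0 := fun i => by
      have e : ((G.neighborFinset i ∩ L).card : ℝ) = ∑ j ∈ L, if G.Adj j i then (1 : ℝ) else 0 := by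
        rw [Finset.sum_boole]
        congr 2
        ext j
        simp [G.adj_comm, and_comm]
      rw [← e, ← sq_abs, sq]
      exact mul_le_mul (hfle2 i) (hfle i) (abs_nonneg _) (by norm_num)
    calc ∑ i, f i ^ 2 ≤ ∑ i, 2 * ∑ j ∈ L, (if G.Adj j i then (1 : ℝ) else 0) :=
          Finset.sum_le_sum fun i _ => h1 i
      _ = 2 * ∑ j ∈ L, (G.degree j : ℝ) := by
          rw [← Finset.mul_sum, Finset.sum_comm]
          congr 1
          refine Finset.sum_congr rfl fun j _ => ?_
          rw [Finset.sum_boole, ← G.card_neighborFinset_eq_degree]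
          congr 2
          ext i
          simp
      _ ≤ 16 * C * ℓ := by
          rw [hL, Finset.sum_pair hxy]
          linarith [(hG.degrees x).2, (hG.degrees y).2]
  have hexp : ∀ S : Finset V, (∀ i ∈ S, i ∉ L) → 2 * S.card ≤ Fintype.card V →
      h * ∑ i ∈ S, ∑ j, a i j ≤ ∑ i ∈ S, ∑ j ∈ Sᶜ, a i j := fun S h1 h2 =>
    expansion_deletedAdj hC₁ hC₁₂ hG (hLcard.le.trans hK) h1 h2
  have hl2 := sum_sq_le_of_poisson a hh0 (by positivity : 0 < δ * C * ℓ / 2)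
    (deletedAdj_nonneg G L) (deletedAdj_comm G L) g f
    (fun S hS => hexp S (fun i hi => hgL i (hS i hi).ne')
      ((Nat.mul_le_mul_left 2 (Finset.card_le_card fun i hi => by
        have h1 := hS i hi
        have h2 := hgL i h1.ne'
        simp only [hg, h2, if_false] at h1
        simpa using h1)).trans hgt))
    (fun S hS => hexp S (fun i hi => hgL i (hS i hi).ne)
      ((Nat.mul_le_mul_left 2 (Finset.card_le_card fun i hi => by
        have h1 := hS i hi
        have h2 := hgL i h1.ne
        simp only [hg, h2, if_false] at h1
        simpa using h1)).trans hlt))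
    (fun i hi => hdegL i (hgL i hi)) (fun i hi => hfeq i (hgL i hi))
  have hM : 4 * C * ℓ * ∑ i, g i ^ 2 ≤ (32 / (h ^ 2 * δ)) ^ 2 := by
    have hq : 0 < h ^ 2 * (δ * C * ℓ / 2) := by positivity
    rw [div_pow, le_div_iff₀ (by positivity)]
    have h1 : (h ^ 2 * (δ * C * ℓ / 2)) ^ 2 * ∑ i, g i ^ 2 ≤ 64 * C * ℓ := by linarith
    have h2 : C * ℓ * (4 * C * ℓ * (∑ i, g i ^ 2) * (h ^ 2 * δ) ^ 2) ≤ C * ℓ * 32 ^ 2 := by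
      linarith
    exact le_of_mul_le_mul_left h2 (by positivity)
  intro i hix hiy
  have hi : i ∉ L := by simp [hL, hix, hiy]
  have hfin := abs_le_of_poisson_apply a (deletedAdj_eq_zero_or_one G L) g i (hdegL i hi)
    ((sum_deletedAdj_le_degree G L hi).trans (hG.degrees i).2.le)
    ((congrArg abs (hfeq i hi)).trans_le (hfle2 i))
    (by positivity : 0 ≤ 32 / (h ^ 2 * δ)) hM
  have hgi : g i = v i - v k := by simp [hg, hi]
  rw [hgi] at hfin
  rw [le_div_iff₀ hℓ0, ← div_le_iff₀ (by positivity)]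
  calc |v i - v k| * ℓ / (2 / (δ * C)) = δ * C * ℓ / 2 * |v i - v k| := by field_simp
    _ ≤ _ := hfin

/-- The extra `1` covers the case in which the other boundary vertex `y` is a neighbour of `x`. -/
theorem abs_sum_neighbor_sub_le {V : Type*} [Fintype V] [DecidableEq V] (G : SimpleGraph V)
    [DecidableRel G.Adj] (x y : V) (v : V → ℝ) {m ε : ℝ} (hε : 0 ≤ ε)
    (hy : |v y - m| ≤ 1) (hv : ∀ i, i ≠ x → i ≠ y → |v i - m| ≤ ε) :
    |∑ j ∈ G.neighborFinset x, (v j - m)| ≤ G.degree x * ε + 1 := by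
  refine (Finset.abs_sum_le_sum_abs _ _).trans ?_
  calc ∑ j ∈ G.neighborFinset x, |v j - m|
      ≤ ∑ j ∈ G.neighborFinset x, (ε + if j = y then 1 else 0) := by
        refine Finset.sum_le_sum fun j hj => ?_
        have hjx : j ≠ x := fun h => by simp [h] at hj
        by_cases hjy : j = y
        · subst hjy; simp; linarith
        · simpa [hjy] using hv j hjx hjy
    _ ≤ G.degree x * ε + 1 := by
        rw [Finset.sum_add_distrib, Finset.sum_const, nsmul_eq_mul,
          G.card_neighborFinset_eq_degree, Finset.sum_ite_eq']
        split_ifs <;> linarith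

theorem corollary3p2 (C₁ C₂ δ C β : ℝ) (K : ℕ) (hC₁ : 0 < C₁) (hC₁₂ : C₁ ≤ C₂) (hδ : 0 < δ)
    (hC : 0 < C) (hβ : 0 < β) (hK : 2 ≤ K) :
    ∃ A : ℝ, 0 < A ∧
      ∀ (V : Type*) [Fintype V] [DecidableEq V] (G : SimpleGraph V) [DecidableRel G.Adj],
        IsProperGraph G C₁ C₂ δ C β K →
        ∀ x y : V, x ≠ y →
        ∀ b v : V → ℝ, b x = 1 → b y = 0 → IsPotential G (fun _ => 1) {x, y} b v →
        ∀ i : V, i ≠ x → i ≠ y →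
          |v i - (G.degree x : ℝ) / ((G.degree x : ℝ) + (G.degree y : ℝ))|
            ≤ A / Real.log (Fintype.card V) := by
  have hC₂ : 0 < C₂ := hC₁.trans_le hC₁₂
  have hδC : 0 < δ * C := by positivity
  set B := (32 / ((C₁ / (6 * C₂)) ^ 2 * δ) + 2) * (2 / (δ * C)) with hB
  have hB0 : 0 < B := by positivity
  refine ⟨2 * B + 4 / (δ * C), by positivity, ?_⟩
  intro V _ _ G _ hG x y hxy b v hbx hby hpot i hix hiy
  have hvx : v x = 1 := by rw [hpot.1 x (by simp), hbx]
  have hvy : v y = 0 := by rw [hpot.1 y (by simp), hby]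
  have hharm : ∀ i ∉ ({x, y} : Finset V), ∑ j ∈ G.neighborFinset i, (v i - v j) = 0 :=
    fun i hi => by simpa only [one_mul] using hpot.2 i hi
  have hle : ∀ i, v i ≤ 1 := le_of_harmonic_off G hG.connected {x, y} (by simp) v 1
    (by simp [hvx, hvy]) hharm
  have hge : ∀ i, 0 ≤ v i := fun i => by
    have := le_of_harmonic_off G hG.connected {x, y} (by simp) (fun i => -v i) 0
      (by simp [hvx, hvy]) (fun i hi => by
        have h := hharm i hi
        rw [← neg_eq_zero, ← Finset.sum_neg_distrib] at h
        rw [← h]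
        exact Finset.sum_congr rfl fun j _ => by ring) i
    linarith
  set ℓ := Real.log (Fintype.card V) with hℓ
  have hℓ0 : 0 < ℓ := by
    have := Fintype.one_lt_card_iff.2 ⟨x, y, hxy⟩
    exact Real.log_pos (by exact_mod_cast this)
  have hdx := (hG.degrees x).1
  have hdy := (hG.degrees y).1
  rw [← hℓ] at hdx hdy
  set dx := (G.degree x : ℝ)
  set dy := (G.degree y : ℝ)
  have hδCℓ : 0 < δ * C * ℓ := by positivity
  have hd : 0 < dx + dy := by linarith
  have hr0 : 0 ≤ dx / (dx + dy) := div_nonneg (by linarith) hd.le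
  have hr1 : dx / (dx + dy) ≤ 1 := (div_le_one hd).2 (by linarith)
  by_cases hlarge : 4 ≤ δ * C * ℓ
  · obtain ⟨m, hm0, hm1, hm⟩ := exists_abs_sub_le hC₁ hC₁₂ hδ hC hK hG hxy
      (fun i => ⟨hge i, hle i⟩) hharm hlarge
    rw [← hB, ← hℓ] at hm
    have hx := abs_sum_neighbor_sub_le G x y v (by positivity)
      (abs_le.2 ⟨by linarith [hge y], by linarith [hle y]⟩) hm
    have hy := abs_sum_neighbor_sub_le G y x v (by positivity)
      (abs_le.2 ⟨by linarith [hge x], by linarith [hle x]⟩) (fun i h1 h2 => hm i h2 h1)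
    have htot := sum_current_boundary G {x, y} v hharm
    rw [Finset.sum_pair hxy] at htot
    have hsum : dx - m * (dx + dy) =
        ∑ j ∈ G.neighborFinset x, (v j - m) + ∑ j ∈ G.neighborFinset y, (v j - m) := by
      simp only [Finset.sum_sub_distrib, Finset.sum_const, nsmul_eq_mul,
        G.card_neighborFinset_eq_degree, hvx, hvy] at htot ⊢
      linarith
    have hmr : |m - dx / (dx + dy)| ≤ B / ℓ + 1 / (δ * C * ℓ) := by
      have e : m - dx / (dx + dy) = -(dx - m * (dx + dy)) / (dx + dy) := by field_simp; ring
      rw [e, abs_div, abs_neg, abs_of_pos hd, div_le_iff₀ hd, hsum]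
      refine (abs_add_le _ _).trans ((add_le_add hx hy).trans ?_)
      have h2 : 2 ≤ 1 / (δ * C * ℓ) * (dx + dy) := by
        rw [one_div_mul_eq_div, le_div_iff₀ hδCℓ]
        linarith
      linarith
    have hvi := hm i hix hiy
    calc |v i - dx / (dx + dy)| ≤ |v i - m| + |m - dx / (dx + dy)| := abs_sub_le _ _ _
      _ ≤ 2 * (B / ℓ) + 4 * (1 / (δ * C * ℓ)) := by
          have : 0 ≤ 1 / (δ * C * ℓ) := by positivity
          linarith
      _ = (2 * B + 4 / (δ * C)) / ℓ := by field_simp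
  · -- for bounded `ℓ` the trivial bound `1` suffices
    refine (abs_le.2 ⟨by linarith [hge i], by linarith [hle i]⟩ : _ ≤ (1 : ℝ)).trans ?_
    rw [le_div_iff₀ hℓ0]
    have : ℓ ≤ 4 / (δ * C) := by
      rw [le_div_iff₀ hδC]; linarith
    linarith
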